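/- Let $M_n$ denote the algebra of complex $n\times n$ matrices and let $\varphi : M_n \to M_n$ be a PPT map, i.e. a completely positive linear map such that $T\circ\varphi$ is also completely positive, where $T$ is the transpose map. Suppose that $\varphi$ is unital ($\varphi(I)=I$) or trace preserving ($\operatorname{Tr}\varphi(X)=\operatorname{Tr}X$ for all $X$). Let $EB$ be the set of entanglement breaking maps on $M_n$, i.e. of those linear maps $\chi : M_n\to M_n$ such that, for every $k$ and every positive semidefinite $A\in M_k\otimes M_n$, the matrix $(\mathrm{id}_k\otimes\chi)(A)$ is separable, that is, a finite sum $\sum_i Q_i\otimes P_i$ with $Q_i\in M_k$ and $P_i\in M_n$ positive semidefinite. Then $\varphi$ is asymptotically entanglement breaking: for every norm on the space of linear maps on $M_n$, with $d$ the induced distance, $$ d(\varphi^k, EB) = \inf_{\chi\in EB}\|\varphi^k-\chi\| \longrightarrow 0 \qquad (k\to\infty), $$ where $\varphi^k$ is the $k$-th iterate of $\varphi$. -/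

import Mathlib

open Filter Topology
open scoped Kronecker ComplexOrder

/-- The algebra `M_n` of complex `n × n` matrices. -/
abbrev Mat (n : ℕ) : Type := Matrix (Fin n) (Fin n) ℂ

section CompletelyPositive

/- Here `M_n` is regarded as a C⋆-algebra: operator norm on `ℂⁿ`, and the Loewner order
(`A ≤ B` iff `B - A` is positive semidefinite). -/
open scoped Matrix.Norms.L2Operator MatrixOrder CStarAlgebra

/-- The linear map `φ : M_p → M_q` is completely positive. -/
def IsCP {p q : ℕ} (φ : Mat p →ₗ[ℂ] Mat q) : Prop :=
  ∃ Φ : Mat p →CP Mat q, Φ.toLinearMap = φ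

end CompletelyPositive

/-- The transpose map `T : M_q → M_q`. -/
def transposeMap (q : ℕ) : Mat q →ₗ[ℂ] Mat q :=
  (Matrix.transposeLinearEquiv (Fin q) (Fin q) ℂ ℂ).toLinearMap

/-- A completely positive map is PPT (positive partial transpose) if its composition with the
transpose map on the range space is still completely positive. -/
def IsPPT {p q : ℕ} (φ : Mat p →ₗ[ℂ] Mat q) : Prop :=
  IsCP φ ∧ IsCP (transposeMap q ∘ₗ φ)

/-- `φ(I) = I`. -/
def IsUnital {p q : ℕ} (φ : Mat p →ₗ[ℂ] Mat q) : Prop :=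
  φ 1 = 1

/-- `Tr φ(X) = Tr X` for all `X`. -/
def IsTracePreserving {p q : ℕ} (φ : Mat p →ₗ[ℂ] Mat q) : Prop :=
  ∀ X : Mat p, (φ X).trace = X.trace

/-- `(id_k ⊗ φ)(A)` for `A ∈ M_k ⊗ M_p`: the map `φ` is applied to each of the `p × p` blocks
of `A`. -/
def idTensor (k : ℕ) {p q : ℕ} (φ : Mat p →ₗ[ℂ] Mat q)
    (A : Matrix (Fin k × Fin p) (Fin k × Fin p) ℂ) :
    Matrix (Fin k × Fin q) (Fin k × Fin q) ℂ :=
  Matrix.of fun x y => φ (Matrix.of fun i j => A (x.1, i) (y.1, j)) x.2 y.2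

/-- An (unnormalized) separable positive matrix in `M_k ⊗ M_q`: a finite sum of tensor products
of positive semidefinite matrices. -/
def IsSeparableMatrix {k q : ℕ} (A : Matrix (Fin k × Fin q) (Fin k × Fin q) ℂ) : Prop :=
  ∃ (r : ℕ) (Q : Fin r → Mat k) (P : Fin r → Mat q),
    (∀ i, (Q i).PosSemidef) ∧ (∀ i, (P i).PosSemidef) ∧ A = ∑ i, Q i ⊗ₖ P i

/-- The map `φ` is entanglement breaking: `id_k ⊗ φ` sends every positive semidefinite matrix
(equivalently, up to normalization, every state) to a separable one, for every `k`. -/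
def IsEntanglementBreaking {p q : ℕ} (φ : Mat p →ₗ[ℂ] Mat q) : Prop :=
  ∀ (k : ℕ) (A : Matrix (Fin k × Fin p) (Fin k × Fin p) ℂ),
    A.PosSemidef → IsSeparableMatrix (idTensor k φ A)

/-- The distance from `φ` to the set of entanglement breaking maps on `M_n`, with respect to the
norm `N` on the space of linear maps on `M_n`. -/
noncomputable def distEB {n : ℕ} (N : Seminorm ℂ (Module.End ℂ (Mat n)))
    (φ : Module.End ℂ (Mat n)) : ℝ :=
  ⨅ ψ : {ψ : Module.End ℂ (Mat n) // IsEntanglementBreaking ψ}, N (φ - ψ.1)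

/-! Pairing the positivity of `φ` and of `T ∘ φ` on 2 × 2 block matrices with positive blocks gives,
when `φ` is unital, two Schwarz inequalities: φ(X*X) dominates both φ(X)*φ(X) and φ(X)φ(X)*. Maps
with these properties (`IsBiSchwarz`) form a closed semigroup of contractions, so the positive
powers of `φ` have compact closure, and this closure contains an idempotent E.

The heart is `IsBiSchwarz.isMeasurePrepare_of_idempotent`. On the support p of the functional Tr
E(·), the two inequalities make fixed points of E normal, hence make them commute. Diagonalizing
them jointly writes E as X ↦ ∑ Tr(F_i X) P_i, which is entanglement breaking. If φ^(m+1) is close to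
E, then every higher power φ^(j+1) φ^(m+1) is as close to φ^(j+1) E, which has the same form.

The trace preserving case follows by passing to the trace dual. -/

open Matrix in
lemma Matrix.PosSemidef.exists_conjTranspose_mul_self {n : ℕ} {A : Mat n} (hA : A.PosSemidef) :
    ∃ B : Mat n, A = Bᴴ * B := by
  open scoped MatrixOrder Matrix.Norms.L2Operator in
  exact CStarAlgebra.nonneg_iff_eq_star_mul_self.1 (Matrix.nonneg_iff_posSemidef.2 hA)

open Matrix in
-- Self-duality of the positive cone; testing on b*b = xx* already suffices.
lemma Matrix.posSemidef_of_trace_mul_nonneg {n : ℕ} {A : Mat n}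
    (h : ∀ b : Mat n, 0 ≤ (A * (bᴴ * b)).trace) : A.PosSemidef := by
  have key : ∀ x : Fin n → ℂ, 0 ≤ star x ⬝ᵥ (A *ᵥ x) := by
    intro x
    obtain ⟨b, hb⟩ := (posSemidef_vecMulVec_self_star x).exists_conjTranspose_mul_self
    have := h b
    rwa [← hb, mul_vecMulVec, trace_vecMulVec, dotProduct_comm] at this
  exact posSemidef_iff_dotProduct_mulVec.2 ⟨isSymmetric_toEuclideanLin_iff.1 <|
    (LinearMap.isSymmetric_iff_inner_map_self_real _).2 fun x => by
      have h1 : inner ℂ (toEuclideanLin A x) x = star (star x.ofLp ⬝ᵥ (A *ᵥ x.ofLp)) := by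
        rw [← inner_conj_symm, EuclideanSpace.inner_eq_star_dotProduct, dotProduct_comm]
        rfl
      rw [h1]
      exact (congrArg star (key x.ofLp).isSelfAdjoint.star_eq), key⟩

/-! ### Two-positivity and two-copositivity -/

section
open scoped Matrix.Norms.L2Operator MatrixOrder CStarAlgebra
open Matrix

/-- Complete positivity at level two, tested against the Hilbert–Schmidt pairing. -/
def IsTwoPositive {n : ℕ} (φ : Module.End ℂ (Mat n)) : Prop :=
  ∀ a b : Fin 2 → Mat n, 0 ≤ ∑ i, ∑ j, (φ ((a i)ᴴ * a j) * ((b j)ᴴ * b i)).trace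

/-- The analogue of `IsTwoPositive` for the composition with the transpose map. -/
def IsTwoCopositive {n : ℕ} (φ : Module.End ℂ (Mat n)) : Prop :=
  ∀ a b : Fin 2 → Mat n, 0 ≤ ∑ i, ∑ j, (φ ((a i)ᴴ * a j) * ((b i)ᴴ * b j)).trace

lemma IsCP.isTwoPositive {n : ℕ} {φ : Module.End ℂ (Mat n)} (h : IsCP φ) : IsTwoPositive φ := by
  obtain ⟨Φ, rfl⟩ := h
  intro a b
  have key : ∀ P : CStarMatrix (Fin 2) (Fin 2) (Mat n), 0 ≤ P →
      0 ≤ ∑ i, ∑ j, (P i j * ((b j)ᴴ * b i)).trace := by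
    intro P hP
    rw [StarOrderedRing.nonneg_iff] at hP
    induction hP using AddSubmonoid.closure_induction with
    | mem P hP =>
      obtain ⟨M, rfl⟩ := hP
      have h1 : ∀ i j, (star M * M) i j = ∑ r, (M r i)ᴴ * M r j := fun i j => rfl
      -- On a square M*M the pairing is a sum of squared Hilbert–Schmidt norms.
      have : ∑ i, ∑ j, ((star M * M) i j * ((b j)ᴴ * b i)).trace =
          ∑ r, ((∑ j, M r j * (b j)ᴴ)ᴴ * (∑ j, M r j * (b j)ᴴ)).trace := by
        have tc : ∀ x y z w : Mat n, (x * y * (z * w)).trace = (w * x * (y * z)).trace := by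
          intro x y z w
          rw [← Matrix.mul_assoc (x * y), trace_mul_comm]
          simp only [Matrix.mul_assoc]
        simp only [h1, Fin.sum_univ_two, conjTranspose_add, conjTranspose_mul,
          conjTranspose_conjTranspose, add_mul, mul_add, trace_add, tc _ _ _ (b _)]
        ring
      rw [this]
      exact Finset.sum_nonneg fun r _ => (posSemidef_conjTranspose_mul_self _).trace_nonneg
    | zero => simp
    | add P Q _ _ hP hQ =>
      refine (add_nonneg hP hQ).trans_eq ?_
      simp only [← Finset.sum_add_distrib, ← trace_add, ← add_mul]
      rfl
  -- With first row a and second row zero, N*N has entries a_i* a_j.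
  let N : CStarMatrix (Fin 2) (Fin 2) (Mat n) := CStarMatrix.ofMatrix (Matrix.of ![a, 0])
  have h1 := key _ (Φ.map_cstarMatrix_nonneg (star N * N) (star_mul_self_nonneg N))
  have h2 : ∀ i j, (star N * N) i j = (a i)ᴴ * a j := by
    intro i j
    have : (star N * N) i j = ∑ r, (N r i)ᴴ * N r j := rfl
    simp [this, Fin.sum_univ_two, N]
  have h3 : ∀ i j, (star N * N).map Φ i j = Φ.toLinearMap ((a i)ᴴ * a j) := by
    intro i j
    rw [← h2]
    rfl
  simpa only [h3] using h1

/-- The transpose moves across the trace onto the b-factor; conjugating the entries of b then leaves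
only the order of the indices swapped. -/
lemma IsPPT.isTwoCopositive {n : ℕ} {φ : Module.End ℂ (Mat n)} (h : IsPPT φ) :
    IsTwoCopositive φ := by
  intro a b
  refine (IsCP.isTwoPositive h.2 a (fun i => (b i).map star)).trans_eq
    (Finset.sum_congr rfl fun i _ => Finset.sum_congr rfl fun j _ => ?_)
  rw [← trace_transpose, transpose_mul, trace_mul_comm]
  congr 1
  have h1 : ((b j).map star)ᴴᵀ = b j := by ext; simp
  rw [transpose_mul, h1]
  rfl
end

/-! ### Trace duality -/

section
open Matrix
/-- The dual of a linear map on `M_n` with respect to the bilinear form `Tr (X * Y)`. -/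
noncomputable def traceDual {n : ℕ} : Module.End ℂ (Mat n) →ₗ[ℂ] Module.End ℂ (Mat n) where
  toFun φ :=
    { toFun := fun X => Matrix.of fun i j => (X * φ (Matrix.single j i 1)).trace
      map_add' := fun X Y => by ext i j; simp [add_mul]
      map_smul' := fun c X => by ext i j; simp }
  map_add' φ ψ := by ext X i j; simp [mul_add]
  map_smul' c φ := by ext X i j; simp

lemma trace_traceDual_mul {n : ℕ} (φ : Module.End ℂ (Mat n)) (X Y : Mat n) :
    (traceDual φ X * Y).trace = (X * φ Y).trace := by
  have : (traceLinearMap (Fin n) ℂ ℂ) ∘ₗ (LinearMap.mulLeft ℂ (traceDual φ X)) =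
      (traceLinearMap (Fin n) ℂ ℂ) ∘ₗ (LinearMap.mulLeft ℂ X) ∘ₗ φ := by
    refine Matrix.ext_linearMap  _ fun i j => ?_
    ext
    simp [traceDual, trace_mul_single]
  exact LinearMap.congr_fun this Y

lemma traceDual_traceDual {n : ℕ} (φ : Module.End ℂ (Mat n)) : traceDual (traceDual φ) = φ := by
  ext1 X
  refine Matrix.ext_iff_trace_mul_right.2 fun Y => ?_
  rw [trace_traceDual_mul, trace_mul_comm, trace_traceDual_mul, trace_mul_comm]

lemma traceDual_mul {n : ℕ} (φ ψ : Module.End ℂ (Mat n)) :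
    traceDual (φ * ψ) = traceDual ψ * traceDual φ := by
  ext1 X
  refine Matrix.ext_iff_trace_mul_right.2 fun Y => ?_
  simp [trace_traceDual_mul]

lemma traceDual_one {n : ℕ} : traceDual (1 : Module.End ℂ (Mat n)) = 1 := by
  ext1 X
  refine Matrix.ext_iff_trace_mul_right.2 fun Y => ?_
  simp [trace_traceDual_mul]

lemma traceDual_pow {n : ℕ} (φ : Module.End ℂ (Mat n)) (k : ℕ) :
    traceDual (φ ^ k) = traceDual φ ^ k := by
  induction k with
  | zero => simp [traceDual_one]
  | succ k ih => rw [pow_succ, traceDual_mul, ih, pow_succ']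

lemma IsTracePreserving.isUnital_traceDual {n : ℕ} {φ : Module.End ℂ (Mat n)}
    (h : IsTracePreserving φ) : IsUnital (traceDual φ) := by
  refine Matrix.ext_iff_trace_mul_right.2 fun Y => ?_
  rw [trace_traceDual_mul, one_mul, one_mul, h Y]

/-- Duality exchanges the roles of a and b, in which the condition is symmetric. -/
lemma IsTwoPositive.traceDual {n : ℕ} {φ : Module.End ℂ (Mat n)} (h : IsTwoPositive φ) :
    IsTwoPositive (traceDual φ) := by
  intro a b
  rw [Finset.sum_comm]
  refine (h b a).trans_eq
    (Finset.sum_congr rfl fun i _ => Finset.sum_congr rfl fun j _ => ?_)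
  rw [trace_traceDual_mul, trace_mul_comm]

lemma IsTwoCopositive.traceDual {n : ℕ} {φ : Module.End ℂ (Mat n)} (h : IsTwoCopositive φ) :
    IsTwoCopositive (traceDual φ) := by
  intro a b
  refine (h b a).trans_eq
    (Finset.sum_congr rfl fun i _ => Finset.sum_congr rfl fun j _ => ?_)
  rw [trace_traceDual_mul, trace_mul_comm]
end
-- Bi-Schwarz maps and measure-and-prepare maps
section
open Matrix

/-- The map sends positive semidefinite matrices to positive semidefinite matrices. -/
def IsPositiveMap {n : ℕ} (φ : Module.End ℂ (Mat n)) : Prop :=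
  ∀ X : Mat n, X.PosSemidef → (φ X).PosSemidef

lemma IsTwoPositive.isPositiveMap {n : ℕ} {φ : Module.End ℂ (Mat n)} (h : IsTwoPositive φ) :
    IsPositiveMap φ := by
  intro X hX
  obtain ⟨x, rfl⟩ := hX.exists_conjTranspose_mul_self
  refine posSemidef_of_trace_mul_nonneg fun b => ?_
  simpa using h ![x, 0] ![b, 0]

lemma IsPositiveMap.map_conjTranspose {n : ℕ} {φ : Module.End ℂ (Mat n)} (h : IsPositiveMap φ)
    (X : Mat n) : φ Xᴴ = (φ X)ᴴ := by
  have pos : ∀ Y : Mat n, φ (Yᴴ * Y) = (φ (Yᴴ * Y))ᴴ := fun Y =>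
    (h _ (posSemidef_conjTranspose_mul_self Y)).1.symm
  have herm : ∀ Y : Mat n, Y.IsHermitian → (φ Y).IsHermitian := by
    intro Y hY
    -- Polarization: a Hermitian matrix is a difference of positive ones.
    have : Y = (1 / 4 : ℂ) • ((Y + 1)ᴴ * (Y + 1) - (Y - 1)ᴴ * (Y - 1)) := by
      simp only [conjTranspose_add, conjTranspose_sub, hY.eq, conjTranspose_one]
      have : (Y + 1) * (Y + 1) - (Y - 1) * (Y - 1) = (4 : ℂ) • Y := by
        simp only [ofNat_smul_eq_nsmul]; noncomm_ring
      rw [this, smul_smul]; norm_num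
    rw [IsHermitian, this, map_smul, map_sub, conjTranspose_smul, conjTranspose_sub, ← pos, ← pos]
    norm_num
  have h1 := herm (X + Xᴴ) (isHermitian_add_transpose_self X)
  have h2 := herm (Complex.I • (X - Xᴴ)) (by
    simp [IsHermitian, ← smul_neg])
  simp only [IsHermitian, map_add, map_smul, map_sub, conjTranspose_add, conjTranspose_smul,
    conjTranspose_sub] at h1 h2
  have h3 := congrArg (fun Z => Complex.I • Z) h2
  simp only [smul_smul, RCLike.star_def, Complex.conj_I, mul_neg, Complex.I_mul_I] at h3
  simp only [neg_neg, one_smul, neg_smul] at h3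
  have h4 : (2 : ℂ) • φ Xᴴ = (2 : ℂ) • (φ X)ᴴ := by
    linear_combination (norm := module) -h1 - h3
  exact smul_right_injective _ two_ne_zero h4

/-- Positive unital maps satisfying the Schwarz inequality for both multiplications on `M_n`. -/
structure IsBiSchwarz {n : ℕ} (φ : Module.End ℂ (Mat n)) : Prop where
  unital : φ 1 = 1
  pos : IsPositiveMap φ
  schwarz : ∀ X : Mat n, (φ (Xᴴ * X) - (φ X)ᴴ * φ X).PosSemidef
  coschwarz : ∀ X : Mat n, (φ (Xᴴ * X) - φ X * (φ X)ᴴ).PosSemidef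

lemma IsTwoPositive.isBiSchwarz {n : ℕ} {φ : Module.End ℂ (Mat n)} (h : IsTwoPositive φ)
    (h' : IsTwoCopositive φ) (h1 : IsUnital φ) : IsBiSchwarz φ where
  unital := h1
  pos := h.isPositiveMap
  schwarz X := by
    refine posSemidef_of_trace_mul_nonneg fun b => ?_
    -- The second entry of b completes the square, as in a Schur complement.
    refine (h ![X, 1] ![b, -(b * (φ X)ᴴ)]).trans_eq ?_
    have e : φ 1 = 1 := h1
    simp [Fin.sum_univ_two, e, h.isPositiveMap.map_conjTranspose, sub_mul, Matrix.mul_assoc]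
    ring
  coschwarz X := by
    refine posSemidef_of_trace_mul_nonneg fun b => ?_
    refine (h' ![X, 1] ![b, -(b * φ X)]).trans_eq ?_
    have e : φ 1 = 1 := h1
    have e1 : ((φ X)ᴴ * (bᴴ * (b * φ X))).trace = (φ X * ((φ X)ᴴ * (bᴴ * b))).trace := by
      rw [← Matrix.mul_assoc bᴴ, ← Matrix.mul_assoc, trace_mul_comm]
    simp [Fin.sum_univ_two, e, h.isPositiveMap.map_conjTranspose, sub_mul, Matrix.mul_assoc, e1]
    exact (sub_eq_add_neg _ _).symm

/-- Apply the outer map to the Schwarz gap of the inner one and add the outer map's own gap at ψ(X).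
-/
lemma IsBiSchwarz.mul {n : ℕ} {φ ψ : Module.End ℂ (Mat n)} (h : IsBiSchwarz φ)
    (h' : IsBiSchwarz ψ) : IsBiSchwarz (φ * ψ) where
  unital := by simp [h.unital, h'.unital]
  pos X hX := h.pos _ (h'.pos _ hX)
  schwarz X := by
    have := (h.pos _ (h'.schwarz X)).add (h.schwarz (ψ X))
    simpa using this
  coschwarz X := by
    have := (h.pos _ (h'.schwarz X)).add (h.coschwarz (ψ X))
    simpa using this

lemma IsBiSchwarz.pow_succ {n : ℕ} {φ : Module.End ℂ (Mat n)} (h : IsBiSchwarz φ) (k : ℕ) :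
    IsBiSchwarz (φ ^ (k + 1)) := by
  induction k with
  | zero => simpa
  | succ k ih => rw [_root_.pow_succ]; exact ih.mul h

/-- Maps of the form `X ↦ ∑ i, Tr (F i * X) • P i` with `F i` and `P i` positive semidefinite. -/
def IsMeasurePrepare {n : ℕ} (χ : Module.End ℂ (Mat n)) : Prop :=
  ∃ (r : ℕ) (F P : Fin r → Mat n), (∀ i, (F i).PosSemidef) ∧ (∀ i, (P i).PosSemidef) ∧
    ∀ X, χ X = ∑ i, (F i * X).trace • P i

lemma IsMeasurePrepare.comp_left {n : ℕ} {χ φ : Module.End ℂ (Mat n)} (h : IsMeasurePrepare χ)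
    (hφ : IsPositiveMap φ) : IsMeasurePrepare (φ * χ) := by
  obtain ⟨r, F, P, hF, hP, h⟩ := h
  exact ⟨r, F, fun i => φ (P i), hF, fun i => hφ _ (hP i), fun X => by simp [h]⟩

lemma IsMeasurePrepare.traceDual {n : ℕ} {χ : Module.End ℂ (Mat n)} (h : IsMeasurePrepare χ) :
    IsMeasurePrepare (traceDual χ) := by
  obtain ⟨r, F, P, hF, hP, h⟩ := h
  refine ⟨r, P, F, hP, hF, fun X => ext_iff_trace_mul_right.2 fun Y => ?_⟩
  simp only [trace_traceDual_mul, h, Finset.mul_sum, Finset.sum_mul, trace_sum, Matrix.mul_smul,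
    Matrix.smul_mul, trace_smul, smul_eq_mul]
  refine Finset.sum_congr rfl fun i _ => ?_
  rw [trace_mul_comm X, mul_comm]

/-- With F = G*G, each row of G contributes a compression W*AW. -/
lemma Matrix.PosSemidef.of_trace_mul_blocks {k n : ℕ} {F : Mat n} (hF : F.PosSemidef)
    {A : Matrix (Fin k × Fin n) (Fin k × Fin n) ℂ} (hA : A.PosSemidef) :
    (Matrix.of fun r s => (F * Matrix.of fun i j => A (r, i) (s, j)).trace : Mat k).PosSemidef := by
  obtain ⟨G, rfl⟩ := hF.exists_conjTranspose_mul_self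
  let W : Fin n → Matrix (Fin k × Fin n) (Fin k) ℂ := fun m =>
    Matrix.of fun x s => if x.1 = s then star (G m x.2) else 0
  have : (Matrix.of fun r s => (Gᴴ * G * Matrix.of fun i j => A (r, i) (s, j)).trace : Mat k) =
      ∑ m, (W m)ᴴ * A * W m := by
    ext r s
    rw [Matrix.sum_apply, of_apply, Matrix.mul_assoc, trace_mul_comm, trace]
    refine Finset.sum_congr rfl fun m _ => ?_
    simp only [W, diag_apply, mul_apply, of_apply, conjTranspose_apply, Fintype.sum_prod_type]
    simp [Finset.sum_mul, apply_ite]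
  rw [this]
  exact posSemidef_sum _ fun m _ => hA.conjTranspose_mul_mul_same _

lemma IsMeasurePrepare.isEntanglementBreaking {n : ℕ} {χ : Module.End ℂ (Mat n)}
    (h : IsMeasurePrepare χ) : IsEntanglementBreaking χ := by
  obtain ⟨r, F, P, hF, hP, h⟩ := h
  intro k A hA
  refine ⟨r, fun l => Matrix.of fun r s => (F l * Matrix.of fun i j => A (r, i) (s, j)).trace, P,
    fun l => (hF l).of_trace_mul_blocks hA, hP, ?_⟩
  ext ⟨r, i⟩ ⟨s, j⟩
  simp [idTensor, h, Matrix.sum_apply]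
end
-- Structure of idempotent bi-Schwarz maps
section
open Matrix

/-- The support projection of a Hermitian matrix. -/
lemma Matrix.IsHermitian.exists_support {n : ℕ} {D : Mat n} (hD : D.IsHermitian) :
    ∃ p g : Mat n, pᴴ = p ∧ p * p = p ∧ D * p = D ∧ p = g * D := by
  have hD' : IsSelfAdjoint D := hD
  have fin : (spectrum ℝ D).Finite := Matrix.finite_real_spectrum
  have cont : ∀ f : ℝ → ℝ, ContinuousOn f (spectrum ℝ D) := fun f => fin.continuousOn f
  -- The indicator of x ≠ 0 equals x⁻¹ · x because 0⁻¹ = 0.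
  let f : ℝ → ℝ := fun x => if x = 0 then 0 else 1
  refine ⟨cfc f D, cfc (fun x : ℝ => x⁻¹) D, cfc_predicate f D, ?_, ?_, ?_⟩
  · rw [← cfc_mul f f D (cont _) (cont _)]
    congr 1; ext x; simp [f]
  · nth_rw 1 [← cfc_id' ℝ D]
    rw [← cfc_mul _ f D (cont _) (cont _)]
    conv_rhs => rw [← cfc_id' ℝ D]
    congr 1; ext x; by_cases hx : x = 0 <;> simp [f, hx]
  · nth_rw 3 [← cfc_id' ℝ D]
    rw [← cfc_mul _ _ D (cont _) (cont _)]
    congr 1; ext x; by_cases hx : x = 0 <;> simp [f, hx]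

/-- For A = a*a and B = b*b, Tr(AB) is the squared Hilbert–Schmidt norm of ab*. -/
lemma Matrix.PosSemidef.mul_eq_zero_of_trace {n : ℕ} {A B : Mat n} (hA : A.PosSemidef)
    (hB : B.PosSemidef) (h : (A * B).trace = 0) : A * B = 0 := by
  obtain ⟨a, rfl⟩ := hA.exists_conjTranspose_mul_self
  obtain ⟨b, rfl⟩ := hB.exists_conjTranspose_mul_self
  have : ((a * bᴴ)ᴴ * (a * bᴴ)).trace = 0 := by
    rw [← h, conjTranspose_mul, conjTranspose_conjTranspose, Matrix.mul_assoc, trace_mul_comm b]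
    simp only [Matrix.mul_assoc]
  have h0 := trace_conjTranspose_mul_self_eq_zero_iff.1 this
  rw [Matrix.mul_assoc, ← Matrix.mul_assoc a, h0]
  simp

lemma Matrix.PosSemidef.eq_zero_of_neg {n : ℕ} {A : Mat n} (hA : A.PosSemidef)
    (hA' : (-A).PosSemidef) : A = 0 := by
  refine hA.trace_eq_zero_iff.1 (le_antisymm ?_ hA.trace_nonneg)
  simpa using hA'.trace_nonneg

/-- Commuting Hermitian matrices are simultaneously diagonalizable by rank one projections. -/
lemma Matrix.exists_joint_diagonalization {n : ℕ} (S : Set (Mat n))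
    (hS : ∀ A ∈ S, A.IsHermitian) (hc : ∀ A ∈ S, ∀ B ∈ S, A * B = B * A) :
    ∃ P : Fin n → Mat n, (∀ i, (P i).PosSemidef) ∧
      ∀ A ∈ S, A = ∑ i, (P i * A).trace • P i := by
  classical
  let T : S → Module.End ℂ (EuclideanSpace ℂ (Fin n)) := fun A => toEuclideanLin A.1
  have hT : ∀ A, LinearMap.IsSymmetric (T A) := fun A =>
    isSymmetric_toEuclideanLin_iff.2 (hS A.1 A.2)
  have hC : Pairwise (Function.onFun Commute T) := by
    intro A B _
    refine LinearMap.ext fun x => ?_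
    simp [T, Matrix.toLpLin_apply, hc A.1 A.2 B.1 B.2]
  have hO := LinearMap.IsSymmetric.orthogonalFamily_iInf_eigenspaces hT
  have hI : DirectSum.IsInternal fun α : S → ℂ => ⨅ j, Module.End.eigenspace (T j) (α j) :=
    LinearMap.IsSymmetric.directSum_isInternal_of_pairwise_commute hT hC
  -- Discarding the zero joint eigenspaces leaves a finite index type, as needed for a subordinate
  -- basis.
  have hI' := DirectSum.isInternal_ne_bot_iff.2 hI
  have hfin := WellFoundedGT.finite_ne_bot_of_iSupIndep hI.submodule_iSupIndep
  have : Fintype {α : S → ℂ // (⨅ j, Module.End.eigenspace (T j) (α j)) ≠ ⊥} := hfin.fintype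
  have hO' := hO.comp (γ := {α : S → ℂ // (⨅ j, Module.End.eigenspace (T j) (α j)) ≠ ⊥})
    (f := Subtype.val) Subtype.val_injective
  let b := hI'.subordinateOrthonormalBasis (finrank_euclideanSpace_fin (𝕜 := ℂ) (n := n)) hO'
  have hb : ∀ i, ∃ α : S → ℂ, ∀ A : S, A.1 *ᵥ (b i).ofLp = α A • (b i).ofLp := by
    intro i
    refine ⟨(hI'.subordinateOrthonormalBasisIndex
      (finrank_euclideanSpace_fin (𝕜 := ℂ) (n := n)) i hO').1, fun A => ?_⟩
    have := hI'.subordinateOrthonormalBasis_subordinate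
      (finrank_euclideanSpace_fin (𝕜 := ℂ) (n := n)) i hO'
    have h2 := Module.End.mem_eigenspace_iff.1 ((Submodule.mem_iInf _).1 this A)
    exact congrArg (fun v => v.ofLp) h2
  choose α hα using hb
  let P : Fin n → Mat n := fun i => vecMulVec (b i).ofLp (star (b i).ofLp)
  have hsum : ∑ i, P i = 1 := by
    refine Matrix.toEuclideanLin.injective (LinearMap.ext fun x => ?_)
    have h1 : toEuclideanLin (1 : Mat n) x = x := by simp
    rw [h1, map_sum, LinearMap.sum_apply]
    conv_rhs => rw [← b.sum_repr' x]
    refine Finset.sum_congr rfl fun i _ => ?_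
    rw [Matrix.toLpLin_apply, vecMulVec_mulVec, EuclideanSpace.inner_eq_star_dotProduct,
      dotProduct_comm]
    ext j
    simp [mul_comm]
  have htr : ∀ i, (P i).trace = 1 := by
    intro i
    rw [trace_vecMulVec]
    have := b.inner_eq_one i
    rwa [EuclideanSpace.inner_eq_star_dotProduct] at this
  have hAP : ∀ (A : S) i, A.1 * P i = α i A • P i := by
    intro A i
    rw [mul_vecMulVec, hα, smul_vecMulVec]
  refine ⟨P, fun i => posSemidef_vecMulVec_self_star _, fun A hA => ?_⟩
  have h2 : ∀ i, (P i * A).trace = α i ⟨A, hA⟩ := fun i => by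
    rw [trace_mul_comm, hAP ⟨A, hA⟩ i, trace_smul, htr, smul_eq_mul, mul_one]
  calc A = A * ∑ i, P i := by rw [hsum, Matrix.mul_one]
    _ = _ := by
      rw [Finset.mul_sum]
      exact Finset.sum_congr rfl fun i _ => by rw [h2, ← hAP ⟨A, hA⟩ i]

/-- An idempotent bi-Schwarz map is determined by its compression to the support of its trace,
and compressing its fixed points there yields a commuting family. -/
lemma IsBiSchwarz.isMeasurePrepare_of_idempotent {n : ℕ} {E : Module.End ℂ (Mat n)}
    (h : IsBiSchwarz E) (hE : E * E = E) : IsMeasurePrepare E := by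
  have star_map := h.pos.map_conjTranspose
  have idem : ∀ X, E (E X) = E X := fun X => LinearMap.congr_fun hE X
  have dualpos : IsPositiveMap (traceDual E) := by
    intro X hX
    obtain ⟨x, rfl⟩ := hX.exists_conjTranspose_mul_self
    refine posSemidef_of_trace_mul_nonneg fun b => ?_
    obtain ⟨c, hc⟩ := (h.pos _ (posSemidef_conjTranspose_mul_self b)).exists_conjTranspose_mul_self
    rw [trace_traceDual_mul, hc, Matrix.mul_assoc, trace_mul_comm]
    have := (posSemidef_conjTranspose_mul_self (c * xᴴ)).trace_nonneg
    simpa [Matrix.mul_assoc] using this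
  set D := traceDual E 1 with hD
  have hDpos : D.PosSemidef := dualpos 1 PosSemidef.one
  have htrD : ∀ X, (D * X).trace = (E X).trace := fun X => by
    rw [hD, trace_traceDual_mul, Matrix.one_mul]
  obtain ⟨p, g, hp, hpp, hDp, hpg⟩ := hDpos.1.exists_support
  -- positive matrices in the kernel of `E` are annihilated by `p`
  have faithful : ∀ X : Mat n, X.PosSemidef → E X = 0 → p * X = 0 := by
    intro X hX hEX
    have := hDpos.mul_eq_zero_of_trace hX (by rw [htrD, hEX, trace_zero])
    rw [hpg, Matrix.mul_assoc, this, Matrix.mul_zero]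
  -- Since D(1 - p) = 0, E(Z*Z) has trace zero and so vanishes; Schwarz then forces E(Z) = 0.
  have kill : ∀ Y : Mat n, E (Y * (1 - p)) = 0 := by
    intro Y
    set Z := Y * (1 - p)
    have hZ : E (Zᴴ * Z) = 0 := by
      refine (h.pos _ (posSemidef_conjTranspose_mul_self Z)).trace_eq_zero_iff.1 ?_
      rw [← htrD, conjTranspose_mul, conjTranspose_sub, conjTranspose_one, hp, Matrix.mul_assoc,
        ← Matrix.mul_assoc D, Matrix.mul_sub, hDp, Matrix.mul_one, sub_self, Matrix.zero_mul,
        trace_zero]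
    have h1 := h.schwarz Z
    rw [hZ, zero_sub] at h1
    exact conjTranspose_mul_self_eq_zero.1
      ((posSemidef_conjTranspose_mul_self (E Z)).eq_zero_of_neg h1)
  have kill' : ∀ Y : Mat n, E ((1 - p) * Y) = 0 := by
    intro Y
    have := congrArg conjTranspose (kill Yᴴ)
    rwa [← star_map, conjTranspose_mul, conjTranspose_sub, conjTranspose_one, hp,
      conjTranspose_conjTranspose, conjTranspose_zero] at this
  have compress : ∀ X, E (p * X * p) = E X := by
    intro X
    have h1 : X = p * X * p + ((1 - p) * (X * p) + X * (1 - p)) := by noncomm_ring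
    conv_rhs => rw [h1, map_add, map_add, kill, kill', add_zero, add_zero]
  -- fixed points leave the range of `p` invariant
  have invariant : ∀ a, E a = a → (1 - p) * (a * p) = 0 := by
    intro a ha
    set y := p * a * p with hy
    have hEy : E y = a := by rw [hy, compress, ha]
    set w := ((1 - p) * (a * p))ᴴ * ((1 - p) * (a * p)) with hw
    have hwy : w = p * (aᴴ * a) * p - yᴴ * y := by
      simp only [hw, hy, conjTranspose_mul, conjTranspose_sub, conjTranspose_one, hp]
      have h1 : (1 - p) * (1 - p) = 1 - p := by
        simp only [Matrix.mul_sub, Matrix.sub_mul, hpp]; simp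
      calc p * aᴴ * (1 - p) * ((1 - p) * (a * p)) = p * aᴴ * ((1 - p) * (1 - p)) * (a * p) := by
            simp only [Matrix.mul_assoc]
        _ = p * (aᴴ * a) * p - p * aᴴ * p * (a * p) := by rw [h1]; noncomm_ring
        _ = p * (aᴴ * a) * p - p * aᴴ * (p * p) * (a * p) := by rw [hpp]
        _ = _ := by simp only [Matrix.mul_assoc]
    -- Here t - w is the p-compression of the Schwarz gap at y, and E kills t. Faithfulness gives t
    -- = 0, so both w and -w are positive.
    set t := p * E (yᴴ * y) * p - yᴴ * y with ht
    have htw : (t - w).PosSemidef := by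
      have h1 := (h.schwarz y).conjTranspose_mul_mul_same p
      rw [hEy, hp] at h1
      convert h1 using 1
      rw [ht, hwy]; noncomm_ring
    have hwpos : w.PosSemidef := posSemidef_conjTranspose_mul_self _
    have htpos : t.PosSemidef := by simpa using htw.add hwpos
    have hpt := faithful t htpos (by rw [ht, map_sub, compress, idem, sub_self])
    have hpt' : t = p * t := by
      rw [ht, Matrix.mul_sub]
      simp only [hy, conjTranspose_mul, hp, ← Matrix.mul_assoc, hpp]
    rw [hpt', hpt, zero_sub] at htw
    exact conjTranspose_mul_self_eq_zero.1 (hwpos.eq_zero_of_neg htw)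
  have sq_le : ∀ a, E a = a → (E (aᴴ * a) - E (a * aᴴ)).PosSemidef := by
    intro a ha
    have := h.pos _ (h.coschwarz a)
    rwa [ha, map_sub, idem] at this
  have normal : ∀ a, E a = a → p * (a * aᴴ) = p * (aᴴ * a) := by
    intro a ha
    have ha' : E aᴴ = aᴴ := by rw [star_map, ha]
    have h1 : E (aᴴ * a) = E (a * aᴴ) := by
      refine sub_eq_zero.1 ((sq_le a ha).eq_zero_of_neg ?_)
      simpa using sq_le _ ha'
    -- The co-Schwarz gap E(b*b) - bb* is positive and killed by E, hence annihilated by p.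
    have key : ∀ b, E b = b → E (bᴴ * b) = E (b * bᴴ) → p * E (bᴴ * b) = p * (b * bᴴ) := by
      intro b hb hbb
      have h2 := h.coschwarz b
      rw [hb] at h2
      have := faithful _ h2 (by rw [map_sub, idem, hbb, sub_self])
      rwa [Matrix.mul_sub, sub_eq_zero] at this
    have h3 := key _ ha' (by simpa using h1.symm)
    rw [conjTranspose_conjTranspose] at h3
    rw [← key a ha h1, ← h3, h1]
  have comm : ∀ a b, E a = a → E b = b → a.IsHermitian → b.IsHermitian →
      p * (a * b) = p * (b * a) := by
    intro a b ha hb ha' hb'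
    -- The cross terms of normality for a + ib give the commutator.
    have := normal (a + Complex.I • b) (by rw [map_add, map_smul, ha, hb])
    simp only [conjTranspose_add, conjTranspose_smul, ha'.eq, hb'.eq, RCLike.star_def,
      Complex.conj_I, add_mul, mul_add, Matrix.smul_mul, Matrix.mul_smul] at this
    have h2 : (2 * Complex.I) • (p * (a * b)) = (2 * Complex.I) • (p * (b * a)) := by
      linear_combination (norm := module) -this
    exact smul_right_injective _ (by simp) h2
  obtain ⟨P, hP, hPS⟩ := exists_joint_diagonalization
    {A : Mat n | ∃ a, E a = a ∧ a.IsHermitian ∧ A = p * a * p}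
    (by
      rintro _ ⟨a, -, ha, rfl⟩
      simp only [IsHermitian, conjTranspose_mul, hp, ha.eq, Matrix.mul_assoc])
    (by
      rintro _ ⟨a, ha, ha', rfl⟩ _ ⟨b, hb, hb', rfl⟩
      have key : ∀ c d, E d = d → p * c * p * (p * d * p) = p * (c * d) * p := by
        intro c d hd
        have h1 : p * (d * p) = d * p := by
          have := invariant d hd
          rw [Matrix.sub_mul, Matrix.one_mul, sub_eq_zero] at this
          exact this.symm
        calc p * c * p * (p * d * p) = p * c * (p * p) * (d * p) := by
              simp only [Matrix.mul_assoc]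
          _ = p * c * (d * p) := by rw [hpp, Matrix.mul_assoc (p * c), h1]
          _ = _ := by simp only [Matrix.mul_assoc]
      rw [key a b hb, key b a ha, comm a b ha hb ha' hb'])
  have diag : ∀ X, p * E X * p = ∑ i, (P i * (p * E X * p)).trace • P i := by
    have herm : ∀ X : Mat n, X.IsHermitian →
        p * E X * p = ∑ i, (P i * (p * E X * p)).trace • P i := fun X hX =>
      hPS _ ⟨E X, idem X, by rw [IsHermitian, ← star_map, hX.eq], rfl⟩
    intro X
    have h1 := herm (X + Xᴴ) (isHermitian_add_transpose_self X)
    have h2 := herm (Complex.I • (X - Xᴴ)) (by simp [IsHermitian, ← smul_neg])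
    simp only [map_add, map_smul, map_sub, mul_add, add_mul, mul_sub, sub_mul, Matrix.mul_smul,
      Matrix.smul_mul, trace_add, trace_sub, trace_smul, add_smul, sub_smul, smul_assoc,
      Finset.sum_add_distrib, Finset.sum_sub_distrib, ← Finset.smul_sum] at h1 h2
    have h2' := smul_right_injective _ Complex.I_ne_zero h2
    have h3 : (2 : ℂ) • (p * E X * p) =
        (2 : ℂ) • ∑ i, (P i * (p * E X * p)).trace • P i := by
      linear_combination (norm := module) h1 + h2'
    exact smul_right_injective _ two_ne_zero h3
  -- Apply E to the diagonal expansion of pE(X)p, then move E and p across the trace onto P_i.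
  refine ⟨n, fun i => traceDual E (p * P i * p), fun i => E (P i), fun i => ?_,
    fun i => h.pos _ (hP i), fun X => ?_⟩
  · have := (hP i).conjTranspose_mul_mul_same p
    rw [hp] at this
    exact dualpos _ this
  · rw [← idem X, ← compress (E X), diag X, map_sum]
    refine Finset.sum_congr rfl fun i _ => ?_
    rw [map_smul, trace_traceDual_mul]
    congr 1
    simp only [Matrix.mul_assoc]
    rw [trace_mul_comm p]
    simp only [Matrix.mul_assoc]

end

/-! ### Compactness and convergence of the powers -/

lemma Seminorm.tendsto_zero_of_finiteDimensional {V : Type*} [NormedAddCommGroup V]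
    [NormedSpace ℂ V] [FiniteDimensional ℂ V] (N : Seminorm ℂ V) : Tendsto N (𝓝 0) (𝓝 0) := by
  let b := Module.finBasis ℂ V
  have hc : Continuous fun v : V => ∑ i, ‖b.repr v i‖ * N (b i) := by
    refine _root_.continuous_finsetSum _ fun i _ => Continuous.mul (Continuous.norm ?_) continuous_const
    exact (b.coord i).continuous_of_finiteDimensional
  have h0 := hc.tendsto 0
  simp only [map_zero, Finsupp.coe_zero, Pi.zero_apply, norm_zero, zero_mul,
    Finset.sum_const_zero] at h0
  refine squeeze_zero (fun v => apply_nonneg N v) (fun v => ?_) h0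
  conv_lhs => rw [← b.sum_repr v]
  exact (Finset.le_sum_of_subadditive N (map_zero N).le (map_add_le_add N) _ _).trans_eq (Finset.sum_congr rfl fun i _ => map_smul_eq_mul N _ _)

section
open Matrix
open scoped Matrix.Norms.L2Operator MatrixOrder

lemma IsBiSchwarz.norm_apply_le {n : ℕ} {φ : Module.End ℂ (Mat n)} (h : IsBiSchwarz φ)
    (X : Mat n) : ‖φ X‖ ≤ ‖X‖ := by
  have h1 : star (φ X) * φ X ≤ φ (star X * X) := h.schwarz X
  have h2 : star X * X ≤ algebraMap ℝ (Mat n) (‖X‖ ^ 2) :=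
    CStarAlgebra.star_mul_le_algebraMap_norm_sq
  have h3 : φ (star X * X) ≤ algebraMap ℝ (Mat n) (‖X‖ ^ 2) := by
    have h4 := h.pos _ h2
    have h5 : algebraMap ℝ (Mat n) (‖X‖ ^ 2) = ((‖X‖ ^ 2 : ℝ) : ℂ) • 1 := by
      rw [Algebra.algebraMap_eq_smul_one, Complex.coe_smul]
    rw [h5, map_sub, map_smul, h.unital, ← h5] at h4
    exact h4
  have h6 := (CStarAlgebra.norm_le_iff_le_algebraMap (star (φ X) * φ X) (by positivity)
    (star_mul_self_nonneg _)).2 (h1.trans h3)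
  rw [CStarRing.norm_star_mul_self, ← sq] at h6
  exact (sq_le_sq₀ (norm_nonneg _) (norm_nonneg _)).1 h6

lemma isClosed_setOf_isBiSchwarz (n : ℕ) :
    IsClosed {f : Mat n →L[ℂ] Mat n | IsBiSchwarz (f : Module.End ℂ (Mat n))} := by
  have hc : IsClosed {A : Mat n | A.PosSemidef} := by
    simp only [← Matrix.nonneg_iff_posSemidef]
    exact isClosed_Ici
  have ev : ∀ X : Mat n, Continuous fun f : Mat n →L[ℂ] Mat n => f X := fun X => by fun_prop
  have : {f : Mat n →L[ℂ] Mat n | IsBiSchwarz (f : Module.End ℂ (Mat n))} =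
      {f | f 1 = 1} ∩ ((⋂ X ∈ {X : Mat n | X.PosSemidef}, {f | (f X).PosSemidef}) ∩
        ((⋂ X : Mat n, {f | (f (Xᴴ * X) - (f X)ᴴ * f X).PosSemidef}) ∩
          ⋂ X : Mat n, {f | (f (Xᴴ * X) - f X * (f X)ᴴ).PosSemidef})) := by
    ext f
    simp only [Set.mem_ofPred_eq, Set.mem_inter_iff, Set.mem_iInter]
    exact ⟨fun h => ⟨h.unital, h.pos, h.schwarz, h.coschwarz⟩,
      fun h => ⟨h.1, h.2.1, h.2.2.1, h.2.2.2⟩⟩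
  rw [this]
  refine (isClosed_eq (ev 1) continuous_const).inter (.inter ?_ (.inter ?_ ?_))
  · exact isClosed_biInter fun X _ => hc.preimage (ev X)
  · exact isClosed_iInter fun X => hc.preimage
      ((ev _).sub ((ev X).matrix_conjTranspose.mul (ev X)))
  · exact isClosed_iInter fun X => hc.preimage
      ((ev _).sub ((ev X).mul (ev X).matrix_conjTranspose))

/-- The powers of a bi-Schwarz map approach the measure-and-prepare maps. -/
lemma IsBiSchwarz.exists_isMeasurePrepare_near {n : ℕ} {φ : Module.End ℂ (Mat n)}
    (h : IsBiSchwarz φ) (N : Seminorm ℂ (Module.End ℂ (Mat n))) {ε : ℝ} (hε : 0 < ε) :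
    ∃ m, ∀ k ≥ m, ∃ χ, IsMeasurePrepare χ ∧ N (φ ^ k - χ) < ε := by
  let e := Module.End.toContinuousLinearMap (𝕜 := ℂ) (Mat n)
  let B : Set (Mat n →L[ℂ] Mat n) := {f | IsBiSchwarz (f : Module.End ℂ (Mat n))}
  have : FiniteDimensional ℂ (Mat n →L[ℂ] Mat n) := e.toLinearEquiv.finiteDimensional
  have : ProperSpace (Mat n →L[ℂ] Mat n) :=
    FiniteDimensional.proper ℂ (Mat n →L[ℂ] Mat n)
  have heB : ∀ ψ, IsBiSchwarz ψ → e ψ ∈ B := fun ψ hψ => hψ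
  have hB1 : ∀ f ∈ B, ‖f‖ ≤ 1 := fun f hf =>
    f.opNorm_le_bound zero_le_one fun X => by simpa using hf.norm_apply_le X
  -- Exponents start at 1: the identity is a useless idempotent, and is not co-Schwarz for n ≥ 2.
  let C : Subsemigroup (Mat n →L[ℂ] Mat n) :=
    { carrier := Set.range fun k : ℕ => e φ ^ (k + 1)
      mul_mem' := by
        rintro _ _ ⟨i, rfl⟩ ⟨j, rfl⟩
        exact ⟨i + 1 + j, by simp only [← pow_add, add_assoc]⟩ }
  let K := C.topologicalClosure
  have hCB : (C : Set (Mat n →L[ℂ] Mat n)) ⊆ B := by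
    rintro _ ⟨k, rfl⟩
    simp only [← map_pow]
    exact heB _ (h.pow_succ k)
  have hKB : (K : Set (Mat n →L[ℂ] Mat n)) ⊆ B :=
    closure_minimal hCB (isClosed_setOf_isBiSchwarz n)
  have hK : IsCompact (K : Set (Mat n →L[ℂ] Mat n)) := by
    refine Metric.isCompact_of_isClosed_isBounded isClosed_closure
      ((Metric.isBounded_closedBall (x := 0) (r := 1)).subset fun f hf => by
      simpa using hB1 f (hKB hf))
  -- Ellis's lemma: a compact semigroup has an idempotent.
  obtain ⟨E, hEK, hEE⟩ := exists_idempotent_in_compact_subsemigroup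
    (fun r => continuous_mul_const r) (K : Set (Mat n →L[ℂ] Mat n))
    ⟨e φ ^ (0 + 1), subset_closure ⟨0, rfl⟩⟩ hK (fun x hx y hy => K.mul_mem hx hy)
  have hMP : IsMeasurePrepare (E : Module.End ℂ (Mat n)) :=
    (hKB hEK).isMeasurePrepare_of_idempotent (congrArg (fun f : Mat n →L[ℂ] Mat n => (f : Module.End ℂ (Mat n))) hEE)
  let N' : Seminorm ℂ (Mat n →L[ℂ] Mat n) := N.comp e.symm.toLinearMap
  have hN' : Tendsto N' (𝓝 0) (𝓝 0) :=
    Seminorm.tendsto_zero_of_finiteDimensional (V := Mat n →L[ℂ] Mat n) N'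
  obtain ⟨δ, hδ, hball⟩ := Metric.tendsto_nhds_nhds.1 hN' ε hε
  obtain ⟨_, ⟨m, rfl⟩, hm⟩ := Metric.mem_closure_iff.1 hEK δ hδ
  -- Write k = (j + 1) + (m + 1); the factor φ^(j+1) is a genuine positive power, hence bi-Schwarz
  -- and contractive.
  refine ⟨m + 2, fun k hk => ?_⟩
  obtain ⟨j, rfl⟩ := Nat.exists_eq_add_of_le hk
  have hj := h.pow_succ j
  refine ⟨φ ^ (j + 1) * (E : Module.End ℂ (Mat n)), hMP.comp_left hj.pos, ?_⟩
  have hfac : φ ^ (m + 2 + j) - φ ^ (j + 1) * (E : Module.End ℂ (Mat n)) =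
      e.symm (e (φ ^ (j + 1)) * (e φ ^ (m + 1) - E)) := by
    rw [← map_pow, map_mul, map_sub, AlgEquiv.symm_apply_apply, AlgEquiv.symm_apply_apply, mul_sub,
      ← pow_add]
    rw [show m + 2 + j = j + 1 + (m + 1) by ring]
    rfl
  rw [hfac]
  have hd : dist (e (φ ^ (j + 1)) * (e φ ^ (m + 1) - E)) 0 < δ := by
    rw [dist_zero_right]
    refine (norm_mul_le _ _).trans_lt ?_
    rw [dist_comm, dist_eq_norm] at hm
    exact (mul_le_of_le_one_left (norm_nonneg _) (hB1 _ (heB _ hj))).trans_lt hm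
  have := hball hd
  rw [dist_zero_right, Real.norm_of_nonneg (apply_nonneg _ _)] at this
  exact this

end

lemma distEB_lt_of_isMeasurePrepare {n : ℕ} (N : Seminorm ℂ (Module.End ℂ (Mat n)))
    {φ χ : Module.End ℂ (Mat n)} (hχ : IsMeasurePrepare χ) {ε : ℝ} (h : N (φ - χ) < ε) :
    distEB N φ < ε :=
  (ciInf_le ⟨0, by rintro _ ⟨ψ, rfl⟩; exact apply_nonneg _ _⟩
    (⟨χ, hχ.isEntanglementBreaking⟩ :
      {ψ : Module.End ℂ (Mat n) // IsEntanglementBreaking ψ})).trans_lt h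

theorem mainTheorem1 (n : ℕ) (φ : Module.End ℂ (Mat n)) (hφ : IsPPT φ)
    (h : IsUnital φ ∨ IsTracePreserving φ)
    (N : Seminorm ℂ (Module.End ℂ (Mat n))) (hN : ∀ f, N f = 0 → f = 0) :
    Tendsto (fun k : ℕ => distEB N (φ ^ k)) atTop (𝓝 0) := by
  have h2 : IsTwoPositive φ := hφ.1.isTwoPositive
  have h2' : IsTwoCopositive φ := hφ.isTwoCopositive
  have near : ∀ ε > 0, ∃ m, ∀ k ≥ m, ∃ χ, IsMeasurePrepare χ ∧ N (φ ^ k - χ) < ε := by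
    intro ε hε
    rcases h with h | h
    · exact (h2.isBiSchwarz h2' h).exists_isMeasurePrepare_near N hε
    -- The dual map is unital; pulling `N` back along `traceDual` makes the estimate return to `φ`
    -- unchanged.
    · obtain ⟨m, hm⟩ := (h2.traceDual.isBiSchwarz h2'.traceDual
        h.isUnital_traceDual).exists_isMeasurePrepare_near (N.comp traceDual) hε
      refine ⟨m, fun k hk => ?_⟩
      obtain ⟨χ, hχ, hlt⟩ := hm k hk
      refine ⟨traceDual χ, hχ.traceDual, ?_⟩
      rwa [Seminorm.comp_apply, map_sub, ← traceDual_pow, traceDual_traceDual] at hlt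
  refine Metric.tendsto_atTop.2 fun ε hε => ?_
  obtain ⟨m, hm⟩ := near ε hε
  refine ⟨m, fun k hk => ?_⟩
  obtain ⟨χ, hχ, hlt⟩ := hm k hk
  have hnn : 0 ≤ distEB N (φ ^ k) := Real.iInf_nonneg fun ψ => apply_nonneg N _
  rw [Real.dist_0_eq_abs, abs_of_nonneg hnn]
  exact distEB_lt_of_isMeasurePrepare N hχ hlt
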